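/- **Setting.** Write $z=(z_1,\dots,z_n)\in\mathbb C^n$, and let $f(t,z,\bar z)=\sum_{\nu,\mu}c_{\nu,\mu}(t)\,z^\nu\bar z^\mu$ be a polynomial in $t\in\mathbb C$, $z$ and $\bar z$ (not depending on $\bar t$). Put $f_t(z,\bar z):=f(t,z,\bar z)$ and $V(f_t):=\{z\in\mathbb C^n\mid f_t(z,\bar z)=0\}$. Assume that for all sufficiently small $t$ we have $\mathbf 0\in V(f_t)$ and $f_t$ does not vanish identically near $\mathbf 0\in\mathbb C^n$. **Definitions.** For a mixed polynomial $k=\sum c_{\nu,\mu}z^\nu\bar z^\mu$: - A point $a$ is a *critical point* of $k=g+\sqrt{-1}\,h$ ($g,h$ real-valued) if the real differentials $dg(a)$ and $dh(a)$ are linearly dependent over $\mathbb R$; the same definition is used for the restriction of $k$ to a complex linear subspace. - The *Newton polygon* $\Gamma_+(k)$ is the convex hull of $\bigcup_{c_{\nu,\mu}\ne0}\big((\nu+\mu)+\mathbb R_{\ge0}^n\big)$, and the *Newton boundary* $\Gamma(k)$ is the union of the compact faces of $\Gamma_+(k)$ (faces are taken to be non-empty). - $k$ is *strongly non-degenerate*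 if for every compact face $\Delta$ of $\Gamma_+(k)$ the function $k_\Delta:=\sum_{\nu+\mu\in\Delta}c_{\nu,\mu}z^\nu\bar z^\mu$ has no critical point on $(\mathbb C\setminus\{0\})^n$. - For $I\subseteq\{1,\dots,n\}$ let $\mathbb C^I:=\{z\mid z_i=0\text{ if }i\notin I\}$ and $\mathbb C^{*I}:=\{z\mid z_i=0\text{ if and only if }i\notin I\}$. Let $\mathscr I_{nv}(k)$ be the set of all $I$ such that $k|_{\mathbb C^I}\not\equiv0$. Let $B_R$ be the open ball of radius $R$, and $S_r$ the sphere of radius $r$, centred at the origin of $\mathbb C^n$. **Proposition.** Suppose that for all sufficiently small $t$ the Newton boundary $\Gamma(f_t)$ is independent of $t$ (that is, $\Gamma(f_t)=\Gamma(f_0)$) and $f_t$ is strongly non-degenerate. Then there exists $R>0$ such that, for all sufficiently small $t$ and all $I\in\mathscr I_{nv}(f_0)$: 1. $V(f_t)\cap\mathbb C^{*I}\cap B_R$ is mixed non-singular, i.e. it contains no critical point of $f_t|_{\mathbb C^I}$; 2. for every $0<r<R$, $V(f_t)\cap\mathbb C^{*I}\cap B_R$ intersects $S_r$ transversely, i.e.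 at every common point $a$ the tangent spaces $T_a\big(V(f_t)\cap\mathbb C^{*I}\big)=\ker d\big(\Re f_t|_{\mathbb C^I}\big)(a)\cap\ker d\big(\Im f_t|_{\mathbb C^I}\big)(a)\subseteq\mathbb C^I$ and $T_aS_r=\{v\mid\Re\langle v,a\rangle=0\}$ together span $\mathbb C^n$ over $\mathbb R$. -/

import Mathlib

open Filter Topology

noncomputable section

namespace MixedNewton

/-- The space `ℂⁿ` with its Hermitian norm. -/
abbrev Cn (n : ℕ) : Type := EuclideanSpace ℂ (Fin n)

/-- Mixed polynomials `∑ c_{ν,μ} z^ν z̄^μ`: polynomials in the `2n` independent symbols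
`z₁, …, zₙ` (the variables `Sum.inl i`) and `z̄₁, …, z̄ₙ` (the variables `Sum.inr i`). -/
abbrev MixedPoly (n : ℕ) : Type := MvPolynomial (Fin n ⊕ Fin n) ℂ

/-- The mixed polynomial function `z ↦ f(z, z̄)`. -/
def MixedPoly.fn {n : ℕ} (f : MixedPoly n) (z : Cn n) : ℂ :=
  MvPolynomial.eval (Sum.elim (fun i => z i) (fun i => (starRingEnd ℂ) (z i))) f

/-- Families `f(t, z, z̄)` that are polynomial in `t`, `z` and `z̄` (and not in `t̄`). -/
abbrev MixedFamily (n : ℕ) : Type := MvPolynomial (Fin n ⊕ Fin n) (Polynomial ℂ)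

/-- The member `f_t` of the family. -/
def MixedFamily.fiber {n : ℕ} (f : MixedFamily n) (t : ℂ) : MixedPoly n :=
  MvPolynomial.map (Polynomial.evalRingHom t) f

/-- The mixed hypersurface `V(f)`. -/
def hypersurface {n : ℕ} (f : MixedPoly n) : Set (Cn n) := {z | f.fn z = 0}

/-- The coordinate subspace `ℂ^I = {z | z_i = 0 if i ∉ I}`. -/
def coordSubspace {n : ℕ} (I : Finset (Fin n)) : Submodule ℂ (Cn n) where
  carrier := {z | ∀ i, i ∉ I → z i = 0}
  add_mem' := by
    intro a b ha hb i hi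
    simp [ha i hi, hb i hi]
  zero_mem' := by
    intro i _
    simp
  smul_mem' := by
    intro c a ha i hi
    simp [ha i hi]

/-- The torus `ℂ^{*I} = {z | z_i = 0 if and only if i ∉ I}`. -/
def coordTorus {n : ℕ} (I : Finset (Fin n)) : Set (Cn n) := {z | ∀ i, z i = 0 ↔ i ∉ I}

/-- The restriction of the function `f(z, z̄)` to `ℂ^I`. -/
def MixedPoly.restrictFn {n : ℕ} (f : MixedPoly n) (I : Finset (Fin n)) :
    coordSubspace I → ℂ := fun z => f.fn (z : Cn n)

/-- The non-vanishing coordinate subsets: those `I` for which `f` restricted to `ℂ^I` is not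
identically zero. -/
def nonVanishing {n : ℕ} (f : MixedPoly n) : Set (Finset (Fin n)) :=
  {I | ∃ z : coordSubspace I, f.restrictFn I z ≠ 0}

section Real

variable {E : Type*} [NormedAddCommGroup E] [NormedSpace ℝ E]

/-- The real differential at `a` of the real part of `F`. -/
def dRe (F : E → ℂ) (a : E) : E →L[ℝ] ℝ := fderiv ℝ (fun z => (F z).re) a

/-- The real differential at `a` of the imaginary part of `F`. -/
def dIm (F : E → ℂ) (a : E) : E →L[ℝ] ℝ := fderiv ℝ (fun z => (F z).im) a

/-- `a` is a critical point of the (mixed polynomial) function `F = g + √-1 h`: the real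
differentials `dg` and `dh` at `a` are linearly dependent over `ℝ`. -/
def IsCriticalPt (F : E → ℂ) (a : E) : Prop := ¬ LinearIndependent ℝ ![dRe F a, dIm F a]

/-- The tangent space at a non-critical point `a` of the level set of `F = g + √-1 h`
through `a`: the vectors killed by `dg` and `dh`. -/
def tangentLevel (F : E → ℂ) (a : E) : Submodule ℝ E :=
  LinearMap.ker (dRe F a).toLinearMap ⊓ LinearMap.ker (dIm F a).toLinearMap

end Real

/-- The point `ν + μ` of `ℝⁿ` attached to the monomial `z^ν z̄^μ`. -/
def radialExp {n : ℕ} (m : (Fin n ⊕ Fin n) →₀ ℕ) : Fin n → ℝ :=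
  fun i => ((m (Sum.inl i) + m (Sum.inr i) : ℕ) : ℝ)

/-- The Newton polygon `Γ₊(f)`: the convex hull of the union of the orthants
`(ν + μ) + ℝ₊ⁿ` over all `(ν, μ)` with `c_{ν,μ} ≠ 0`. -/
def newtonPolygon {n : ℕ} (f : MixedPoly n) : Set (Fin n → ℝ) :=
  convexHull ℝ (⋃ m ∈ f.support, {ξ | radialExp m ≤ ξ})

/-- `Δ` is a compact face of `Γ₊(f)`: non-empty, compact, and the locus in `Γ₊(f)` where some
linear form attains its extremum over `Γ₊(f)`. -/
def IsCompactFace {n : ℕ} (f : MixedPoly n) (Δ : Set (Fin n → ℝ)) : Prop :=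
  Δ.Nonempty ∧ IsCompact Δ ∧ IsExposed ℝ (newtonPolygon f) Δ

/-- The Newton boundary `Γ(f)`: the union of the compact faces of `Γ₊(f)`. -/
def newtonBoundary {n : ℕ} (f : MixedPoly n) : Set (Fin n → ℝ) :=
  ⋃₀ {Δ | IsCompactFace f Δ}

open Classical in
/-- The face function `f_Δ = ∑_{ν + μ ∈ Δ} c_{ν,μ} z^ν z̄^μ`. -/
def facePoly {n : ℕ} (f : MixedPoly n) (Δ : Set (Fin n → ℝ)) : MixedPoly n :=
  ∑ m ∈ f.support with radialExp m ∈ Δ, MvPolynomial.monomial m (f.coeff m)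

/-- `f` is strongly non-degenerate: for every compact face `Δ`, the face function `f_Δ` has no
critical point on `(ℂ^*)ⁿ`. -/
def StronglyNonDegenerate {n : ℕ} (f : MixedPoly n) : Prop :=
  ∀ Δ, IsCompactFace f Δ → ∀ z : Cn n, (∀ i, z i ≠ 0) → ¬ IsCriticalPt (facePoly f Δ).fn z

/-- `V(f) ∩ ℂ^{*I} ∩ B_R` is mixed non-singular: none of its points is a critical point of the
restriction of `f` to `ℂ^I`. -/
def MixedNonSingularOn {n : ℕ} (f : MixedPoly n) (I : Finset (Fin n)) (R : ℝ) : Prop :=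
  ∀ a : coordSubspace I,
    (a : Cn n) ∈ hypersurface f ∩ coordTorus I ∩ Metric.ball 0 R →
      ¬ IsCriticalPt (f.restrictFn I) a

/-- The tangent space in `ℂⁿ` of `V(f) ∩ ℂ^{*I}` at a mixed non-singular point `a`. -/
def tangentStratum {n : ℕ} (f : MixedPoly n) (I : Finset (Fin n)) (a : coordSubspace I) :
    Submodule ℝ (Cn n) :=
  (tangentLevel (f.restrictFn I) a).map ((coordSubspace I).subtype.restrictScalars ℝ)

/-- The tangent space at `a` of the sphere with centre `0` through `a`: the vectors that are
orthogonal to `a` for the Euclidean inner product `Re ⟨·,·⟩`. -/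
def tangentSphere {n : ℕ} (a : Cn n) : Submodule ℝ (Cn n) where
  carrier := {v | (inner ℂ a v).re = 0}
  add_mem' := by
    intro v w hv hw
    simp only [Set.mem_ofPred_eq] at hv hw ⊢
    rw [inner_add_right, Complex.add_re, hv, hw, add_zero]
  zero_mem' := by simp
  smul_mem' := by
    intro c v hv
    simp only [Set.mem_ofPred_eq] at hv ⊢
    rw [inner_smul_right_eq_smul, Complex.smul_re, hv, smul_zero]

/-- `V(f) ∩ ℂ^{*I} ∩ B_R` intersects the sphere `S_r` transversely: at each common point the two
tangent spaces span `ℂⁿ` over `ℝ`. -/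
def TransverseToSphere {n : ℕ} (f : MixedPoly n) (I : Finset (Fin n)) (R r : ℝ) : Prop :=
  ∀ a : coordSubspace I,
    (a : Cn n) ∈ hypersurface f ∩ coordTorus I ∩ Metric.ball 0 R → (a : Cn n) ∈ Metric.sphere 0 r →
      tangentStratum f I a ⊔ tangentSphere (a : Cn n) = ⊤

end MixedNewton

end

open MixedNewton

/-! The argument is a blow-up by contradiction, with ultrafilters in place of a curve selection
lemma. Both conclusions follow from one statement, `RadiallyIndependent`: on `ℂ^I` the differentials
of `Re f_t`, `Im f_t` and the squared distance are linearly independent over `ℝ`. If this fails at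
zeros in `ℂ^{*I}` arbitrarily close to `(0, 0)`, fix an ultrafilter of such pairs `(t, a)` tending
to the origin.

The weights `x_i = -log |a_i|`, `i ∈ I`, tend to infinity. By `exists_asymptotic_face` they stay at
bounded distance from weights `y` for which the minimal exponents of `f_0` on `I` are exactly tied,
while all others are infinitely heavier. Rescaling coordinates by `exp y` moves `a` to points
converging to some `b ∈ ℂ^{*I}`, and the rescaled `f_t` converge to a face function `g` of `f_0`
(`exists_blowup`). Monomials absent from `f_0` disappear in the limit: constancy of the Newton
boundary bounds their scaling factors, and their coefficients tend to zero.

The linear relations, normalized, converge to a nontrivial relation between `Re dg`, `Im dg` and a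
limit radial functional at `b`. As `g b = 0`, Euler's identity for a positive weight `w` of the face
gives `dg (w b) = 0`, whereas the radial functional is positive on `w b`. Its coefficient therefore
vanishes, so `b` is critical for `g` on `ℂ^I`. Since `g` involves only the variables in `I`, setting
the other coordinates to one gives a critical point on the full torus, against strong non-degeneracy
of `f_0`. -/

noncomputable section

namespace MixedNewton

variable {n : ℕ}

/-! ### Newton polygons and the faces cut out by positive weights. -/

section NewtonPolygon

theorem radialExp_mem_newtonPolygon {f : MixedPoly n} {m : (Fin n ⊕ Fin n) →₀ ℕ}
    (hm : m ∈ f.support) : radialExp m ∈ newtonPolygon f :=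
  subset_convexHull ℝ _ (Set.mem_biUnion hm (le_refl (radialExp m)))

theorem radialExp_nonneg (m : (Fin n ⊕ Fin n) →₀ ℕ) : 0 ≤ radialExp m :=
  fun _ => Nat.cast_nonneg _

theorem le_dotProduct_of_mem_newtonPolygon {f : MixedPoly n} {w : Fin n → ℝ} (hw : 0 ≤ w) {d : ℝ}
    (hd : ∀ m ∈ f.support, d ≤ radialExp m ⬝ᵥ w) {ξ : Fin n → ℝ} (hξ : ξ ∈ newtonPolygon f) :
    d ≤ ξ ⬝ᵥ w := by
  have hconv : Convex ℝ {ξ : Fin n → ℝ | d ≤ ξ ⬝ᵥ w} :=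
    convex_halfSpace_ge ⟨fun x y => add_dotProduct x y w, fun c x => smul_dotProduct c x w⟩ d
  refine convexHull_min ?_ hconv hξ
  intro η hη
  simp only [Set.mem_iUnion] at hη
  obtain ⟨m, hm, hη⟩ := hη
  exact (hd m hm).trans (dotProduct_le_dotProduct_of_nonneg_right hη hw)

theorem nonneg_of_mem_newtonPolygon {f : MixedPoly n} {ξ : Fin n → ℝ}
    (hξ : ξ ∈ newtonPolygon f) : 0 ≤ ξ := by
  refine convexHull_min ?_ (convex_Ici (0 : Fin n → ℝ)) hξ
  intro η hη
  simp only [Set.mem_iUnion] at hη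
  obtain ⟨m, _, hη⟩ := hη
  exact (radialExp_nonneg m).trans hη

open scoped Pointwise in
-- The polygon is the sum of the convex hull of finitely many points, which is compact, and the
-- closed orthant.
theorem isClosed_newtonPolygon (f : MixedPoly n) : IsClosed (newtonPolygon f) := by
  have h : (⋃ m ∈ f.support, {ξ | radialExp m ≤ ξ}) =
      (radialExp '' (f.support : Set ((Fin n ⊕ Fin n) →₀ ℕ))) + Set.Ici (0 : Fin n → ℝ) := by
    ext ξ
    simp only [Set.mem_iUnion, Set.mem_add, Set.mem_image, Set.mem_Ici, Set.mem_ofPred_eq]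
    constructor
    · rintro ⟨m, hm, hξ⟩
      exact ⟨_, ⟨m, hm, rfl⟩, ξ - radialExp m, sub_nonneg.2 hξ, add_sub_cancel _ _⟩
    · rintro ⟨_, ⟨m, hm, rfl⟩, η, hη, rfl⟩
      exact ⟨m, hm, le_add_of_nonneg_right hη⟩
  rw [newtonPolygon, h, convexHull_add, (convex_Ici (0 : Fin n → ℝ)).convexHull_eq]
  exact isClosed_Ici.add_left_of_isCompact ((f.support.finite_toSet.image _).isCompact_convexHull ℝ)

/-- A strictly positive weight cuts out a compact face. -/
theorem isCompactFace_of_pos {f : MixedPoly n} {w : Fin n → ℝ} (hw : ∀ i, 0 < w i) {d : ℝ}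
    (hd : ∀ m ∈ f.support, d ≤ radialExp m ⬝ᵥ w) {m₀ : (Fin n ⊕ Fin n) →₀ ℕ}
    (hm₀ : m₀ ∈ f.support) (hd₀ : radialExp m₀ ⬝ᵥ w = d) :
    IsCompactFace f {ξ ∈ newtonPolygon f | ξ ⬝ᵥ w = d} := by
  have hw0 : 0 ≤ w := fun i => (hw i).le
  have hcont : Continuous fun ξ : Fin n → ℝ => ξ ⬝ᵥ w := by
    unfold dotProduct; fun_prop
  refine ⟨⟨_, radialExp_mem_newtonPolygon hm₀, hd₀⟩, ?_, ?_⟩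
  -- Coordinates are nonnegative, so `ξ ⬝ᵥ w = d` forces `ξ i ≤ d / w i`: positivity of every weight
  -- bounds the face.
  · refine (isCompact_Icc (a := (0 : Fin n → ℝ)) (b := fun i => d / w i)).of_isClosed_subset
      ((isClosed_newtonPolygon f).inter (isClosed_eq hcont continuous_const)) ?_
    rintro ξ ⟨hξ, hξd⟩
    have h0 := nonneg_of_mem_newtonPolygon hξ
    refine ⟨h0, fun i => ?_⟩
    rw [le_div_iff₀ (hw i), ← hξd]
    exact Finset.single_le_sum (f := fun i => ξ i * w i)
      (fun j _ => mul_nonneg (h0 j) (hw0 j)) (Finset.mem_univ i)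
  · intro _
    -- The sign turns the minimum into a maximum, as `IsExposed` requires.
    let l : (Fin n → ℝ) →ₗ[ℝ] ℝ :=
      { toFun := fun ξ => -(ξ ⬝ᵥ w)
        map_add' := fun x y => by rw [add_dotProduct]; ring
        map_smul' := fun c x => by simp [smul_dotProduct] }
    refine ⟨l.toContinuousLinearMap, ?_⟩
    ext ξ
    constructor
    · rintro ⟨hξ, hξd⟩
      refine ⟨hξ, fun η hη => ?_⟩
      have := le_dotProduct_of_mem_newtonPolygon hw0 hd hη
      change -(η ⬝ᵥ w) ≤ -(ξ ⬝ᵥ w)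
      linarith
    · rintro ⟨hξ, h⟩
      have h1 : -(radialExp m₀ ⬝ᵥ w) ≤ -(ξ ⬝ᵥ w) := h _ (radialExp_mem_newtonPolygon hm₀)
      exact ⟨hξ, le_antisymm (by linarith) (le_dotProduct_of_mem_newtonPolygon hw0 hd hξ)⟩

theorem newtonBoundary_subset_newtonPolygon (f : MixedPoly n) :
    newtonBoundary f ⊆ newtonPolygon f :=
  Set.sUnion_subset fun _ hΔ => hΔ.2.2.subset

/-- The minimum of a positive weight on the support only depends on the Newton boundary. -/
theorem le_dotProduct_of_newtonBoundary_subset {f g : MixedPoly n}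
    (h : newtonBoundary f ⊆ newtonBoundary g) {w : Fin n → ℝ} (hw : ∀ i, 0 < w i) {d : ℝ}
    (hd : ∀ m ∈ g.support, d ≤ radialExp m ⬝ᵥ w) {m : (Fin n ⊕ Fin n) →₀ ℕ}
    (hm : m ∈ f.support) : d ≤ radialExp m ⬝ᵥ w := by
  -- A minimizer of the weight over `f` lies on a compact face of `f`, hence in the polygon of `g`,
  -- where the bound `d` holds.
  obtain ⟨m₀, hm₀, hmin⟩ := f.support.exists_min_image (fun m => radialExp m ⬝ᵥ w) ⟨m, hm⟩
  have hface := isCompactFace_of_pos hw hmin hm₀ rfl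
  have hmem : radialExp m₀ ∈ newtonBoundary f :=
    ⟨_, hface, radialExp_mem_newtonPolygon hm₀, rfl⟩
  exact (le_dotProduct_of_mem_newtonPolygon (fun i => (hw i).le) hd
    (newtonBoundary_subset_newtonPolygon g (h hmem))).trans (hmin m hm)

end NewtonPolygon

/-! ### Mixed monomials, diagonal scalings and restriction to coordinate subspaces. -/

section Function

/-- The monomial function `z ↦ z^ν z̄^μ`. -/
def mixedMonomial (m : (Fin n ⊕ Fin n) →₀ ℕ) (z : Cn n) : ℂ :=
  ∏ i, z i ^ m (Sum.inl i) * (starRingEnd ℂ) (z i) ^ m (Sum.inr i)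

theorem fn_monomial (m : (Fin n ⊕ Fin n) →₀ ℕ) (c : ℂ) (z : Cn n) :
    MixedPoly.fn (MvPolynomial.monomial m c) z = c * mixedMonomial m z := by
  rw [MixedPoly.fn, MvPolynomial.eval_monomial, Finsupp.prod_fintype _ _ (by simp),
    Fintype.prod_sum_type, ← Finset.prod_mul_distrib]
  rfl

theorem fn_eq_sum (f : MixedPoly n) (z : Cn n) :
    f.fn z = ∑ m ∈ f.support, f.coeff m * mixedMonomial m z := by
  conv_lhs => rw [f.as_sum, MixedPoly.fn, map_sum]
  exact Finset.sum_congr rfl fun m _ => fn_monomial m _ z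

theorem contDiff_mixedMonomial (m : (Fin n ⊕ Fin n) →₀ ℕ) :
    ContDiff ℝ 1 (mixedMonomial m : Cn n → ℂ) := by
  have h : ∀ i, ContDiff ℝ 1 (fun z : Cn n => z i) := fun i =>
    ((EuclideanSpace.proj i : Cn n →L[ℂ] ℂ).restrictScalars ℝ).contDiff
  unfold mixedMonomial
  refine contDiff_prod fun i _ => ((h i).pow _).mul (ContDiff.pow ?_ _)
  exact Complex.conjCLE.contDiff.comp (h i)

theorem contDiff_fn (f : MixedPoly n) : ContDiff ℝ 1 f.fn := by
  rw [show f.fn = _ from funext (fn_eq_sum f)]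
  exact ContDiff.sum fun m _ => contDiff_const.mul (contDiff_mixedMonomial m)

theorem differentiable_fn (f : MixedPoly n) : Differentiable ℝ f.fn :=
  (contDiff_fn f).differentiable one_ne_zero

theorem differentiable_mixedMonomial (m : (Fin n ⊕ Fin n) →₀ ℕ) :
    Differentiable ℝ (mixedMonomial m : Cn n → ℂ) :=
  (contDiff_mixedMonomial m).differentiable one_ne_zero

/-- Summing over the support of the whole family gives an index set independent of `t`, so limits
can be taken term by term. -/
theorem fiber_fn (f : MixedFamily n) (t : ℂ) (z : Cn n) :
    (f.fiber t).fn z = ∑ m ∈ f.support, (f.coeff m).eval t * mixedMonomial m z := by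
  rw [fn_eq_sum]
  have hc : ∀ m, (f.fiber t).coeff m = (f.coeff m).eval t := fun m => by
    rw [MixedFamily.fiber, MvPolynomial.coeff_map]; rfl
  simp only [hc]
  refine Finset.sum_subset (MvPolynomial.support_map_subset _ _) fun m _ hm => ?_
  rw [← hc, MvPolynomial.notMem_support_iff.1 hm, zero_mul]

theorem coeff_fiber (f : MixedFamily n) (t : ℂ) (m : (Fin n ⊕ Fin n) →₀ ℕ) :
    (f.fiber t).coeff m = (f.coeff m).eval t := by
  rw [MixedFamily.fiber, MvPolynomial.coeff_map]; rfl

/-- The diagonal real linear map with real entries `c`. -/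
def diagMap (c : Fin n → ℝ) : Cn n →L[ℝ] Cn n :=
  LinearMap.toContinuousLinearMap
    { toFun := fun v => WithLp.toLp 2 fun i => (c i : ℂ) * v i
      map_add' := fun v w => by ext i; simp [mul_add]
      map_smul' := fun r v => by ext i; simp; ring }

@[simp] theorem diagMap_apply (c : Fin n → ℝ) (v : Cn n) (i : Fin n) :
    diagMap c v i = (c i : ℂ) * v i := rfl

theorem diagMap_mem (c : Fin n → ℝ) {I : Finset (Fin n)} {v : Cn n} (hv : v ∈ coordSubspace I) :
    diagMap c v ∈ coordSubspace I := fun i hi => by rw [diagMap_apply, hv i hi, mul_zero]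

theorem mixedMonomial_diagMap (m : (Fin n ⊕ Fin n) →₀ ℕ) (c : Fin n → ℝ) (z : Cn n) :
    mixedMonomial m (diagMap c z) =
      ((∏ i, c i ^ (m (Sum.inl i) + m (Sum.inr i)) : ℝ) : ℂ) * mixedMonomial m z := by
  simp only [mixedMonomial, diagMap_apply, map_mul, Complex.conj_ofReal, Complex.ofReal_prod,
    ← Finset.prod_mul_distrib, Complex.ofReal_pow]
  exact Finset.prod_congr rfl fun i _ => by ring

theorem mixedMonomial_diagMap_exp (m : (Fin n ⊕ Fin n) →₀ ℕ) (w : Fin n → ℝ) (z : Cn n) :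
    mixedMonomial m (diagMap (fun i => Real.exp (w i)) z) =
      (Real.exp (radialExp m ⬝ᵥ w) : ℂ) * mixedMonomial m z := by
  rw [mixedMonomial_diagMap]
  congr 2
  rw [dotProduct, Real.exp_sum]
  exact Finset.prod_congr rfl fun i _ => by rw [← Real.exp_nat_mul]; rfl

/-- The exponent `m` only involves the variables with index in `I`. -/
def SupportedOn (I : Finset (Fin n)) (m : (Fin n ⊕ Fin n) →₀ ℕ) : Prop :=
  ∀ i, i ∉ I → radialExp m i = 0

theorem mixedMonomial_eq_zero {I : Finset (Fin n)} {m : (Fin n ⊕ Fin n) →₀ ℕ}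
    (hm : ¬ SupportedOn I m) {z : Cn n} (hz : z ∈ coordSubspace I) : mixedMonomial m z = 0 := by
  simp only [SupportedOn, not_forall] at hm
  obtain ⟨i, hi, hne⟩ := hm
  have h0 : m (Sum.inl i) + m (Sum.inr i) ≠ 0 := fun h => hne (by simp [radialExp, h])
  refine Finset.prod_eq_zero (Finset.mem_univ i) ?_
  rw [hz i hi, map_zero, ← pow_add, zero_pow h0]

theorem mixedMonomial_congr {I : Finset (Fin n)} {m : (Fin n ⊕ Fin n) →₀ ℕ}
    (hm : SupportedOn I m) {z z' : Cn n} (h : ∀ i ∈ I, z i = z' i) :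
    mixedMonomial m z = mixedMonomial m z' := by
  refine Finset.prod_congr rfl fun i _ => ?_
  by_cases hi : i ∈ I
  · rw [h i hi]
  · have h0 : m (Sum.inl i) + m (Sum.inr i) = 0 := by
      have h := hm i hi
      unfold radialExp at h
      exact_mod_cast h
    rw [Nat.add_eq_zero_iff] at h0
    rw [h0.1, h0.2]; simp

theorem exists_supportedOn_of_mem_nonVanishing {f : MixedPoly n} {I : Finset (Fin n)}
    (hI : I ∈ nonVanishing f) : ∃ m ∈ f.support, SupportedOn I m := by
  obtain ⟨z, hz⟩ := hI
  by_contra! h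
  refine hz ?_
  rw [MixedPoly.restrictFn, fn_eq_sum]
  exact Finset.sum_eq_zero fun m hm => by rw [mixedMonomial_eq_zero (h m hm) z.2, mul_zero]

theorem facePoly_fn (f : MixedPoly n) (Δ : Set (Fin n → ℝ)) (z : Cn n) :
    (facePoly f Δ).fn z =
      open Classical in ∑ m ∈ f.support with radialExp m ∈ Δ, f.coeff m * mixedMonomial m z := by
  rw [facePoly, MixedPoly.fn, map_sum]
  exact Finset.sum_congr rfl fun m _ => fn_monomial m _ z

theorem dRe_apply {E : Type*} [NormedAddCommGroup E] [NormedSpace ℝ E] {F : E → ℂ} {a : E}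
    (hF : DifferentiableAt ℝ F a) (v : E) : dRe F a v = (fderiv ℝ F a v).re := by
  have := (Complex.reCLM.hasFDerivAt.comp a hF.hasFDerivAt).fderiv
  exact congrArg (fun l => l v) this

theorem dIm_apply {E : Type*} [NormedAddCommGroup E] [NormedSpace ℝ E] {F : E → ℂ} {a : E}
    (hF : DifferentiableAt ℝ F a) (v : E) : dIm F a v = (fderiv ℝ F a v).im := by
  have := (Complex.imCLM.hasFDerivAt.comp a hF.hasFDerivAt).fderiv
  exact congrArg (fun l => l v) this

theorem hasFDerivAt_restrictFn (f : MixedPoly n) (I : Finset (Fin n)) (a : coordSubspace I) :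
    HasFDerivAt (f.restrictFn I)
      ((fderiv ℝ f.fn a).comp ((coordSubspace I).subtypeL.restrictScalars ℝ)) a :=
  ((differentiable_fn f _).hasFDerivAt).comp a
    ((coordSubspace I).subtypeL.restrictScalars ℝ).hasFDerivAt

end Function

/-! ### Asymptotics of weights along an ultrafilter. -/

/-- Points at which a linear map is bounded stay at bounded distance from its kernel. -/
theorem exists_mem_ker_norm_sub_le {V W : Type*} [NormedAddCommGroup V] [NormedSpace ℝ V]
    [FiniteDimensional ℝ V] [NormedAddCommGroup W] [NormedSpace ℝ W] [FiniteDimensional ℝ W]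
    (T : V →ₗ[ℝ] W) : ∃ C : ℝ, 0 < C ∧ ∀ x, ∃ y, T y = 0 ∧ ‖x - y‖ ≤ C * ‖T x‖ := by
  have : CompleteSpace V := FiniteDimensional.complete ℝ V
  have : CompleteSpace (LinearMap.range T) := FiniteDimensional.complete ℝ _
  obtain ⟨C, hC, h⟩ := T.rangeRestrict.toContinuousLinearMap.exists_preimage_norm_le
    T.surjective_rangeRestrict
  refine ⟨C, hC, fun x => ?_⟩
  obtain ⟨u, hu, hle⟩ := h ⟨T x, x, rfl⟩
  have hu' : T u = T x := congrArg Subtype.val hu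
  exact ⟨x - u, by rw [map_sub, hu', sub_self], by simpa using hle⟩

/-- For an ultrafilter, failing to be eventually at most `C` means being eventually greater than
`C`. -/
theorem tendsto_atTop_of_not_bounded {ι : Type*} (U : Ultrafilter ι) {φ : ι → ℝ}
    (h : ¬ ∃ C, ∀ᶠ k in U, φ k ≤ C) : Tendsto φ U atTop := by
  push Not at h
  refine tendsto_atTop.2 fun C => ?_
  exact (h C).mono fun k hk => hk.le

/-- Along an ultrafilter, a sequence of weights `x` is at bounded distance from a sequence of
weights `y` whose minimum on the finite set `S` is attained exactly on a fixed subset, away from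
which it is approached at infinite distance only. -/
theorem exists_asymptotic_face {ι : Type*} (U : Ultrafilter ι) (I : Finset (Fin n))
    {S : Finset (Fin n → ℝ)} (hS : S.Nonempty) (x : ι → Fin n → ℝ)
    (hx : ∀ k i, i ∉ I → x k i = 0) :
    ∃ α ∈ S, ∃ y : ι → Fin n → ℝ, ∃ C : ℝ, (∀ᶠ k in U, ∀ β ∈ S, α ⬝ᵥ x k ≤ β ⬝ᵥ x k) ∧
      (∀ k i, i ∉ I → y k i = 0) ∧ (∀ᶠ k in U, ‖x k - y k‖ ≤ C) ∧
      ∀ β ∈ S, (∀ k, β ⬝ᵥ y k = α ⬝ᵥ y k) ∨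
        Tendsto (fun k => β ⬝ᵥ y k - α ⬝ᵥ y k) U atTop := by
  classical
  obtain ⟨α, hα, hmin⟩ : ∃ α ∈ S, ∀ᶠ k in U, ∀ β ∈ S, α ⬝ᵥ x k ≤ β ⬝ᵥ x k := by
    have h : ∀ᶠ k in U, ∃ α ∈ S, ∀ β ∈ S, α ⬝ᵥ x k ≤ β ⬝ᵥ x k :=
      Eventually.of_forall fun k => S.exists_min_image (fun β => β ⬝ᵥ x k) hS
    -- Pigeonhole: an ultrafilter selects one of the finitely many candidates for the minimizer.
    by_contra! hcon
    have h2 : ∀ᶠ k in U, ∀ α ∈ S, ¬ ∀ β ∈ S, α ⬝ᵥ x k ≤ β ⬝ᵥ x k :=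
      (Finset.eventually_all S).2 fun α hα => (hcon α hα).mono fun k ⟨β, hβ, hlt⟩ hle => (hle β hβ).not_gt hlt
    obtain ⟨k, ⟨α, hα, h3⟩, h4⟩ := (h.and h2).exists
    exact h4 α hα h3
  let P : (Fin n → ℝ) → Prop := fun β => ∃ C, ∀ᶠ k in U, β ⬝ᵥ x k - α ⬝ᵥ x k ≤ C
  let D := S.filter P
  -- The kernel of `T` consists of the weights that tie all of `D` with `α` and vanish off `I`. As
  -- `T (x k)` is bounded, `x k` can be moved into this kernel by a bounded amount.
  let T : (Fin n → ℝ) →ₗ[ℝ] ((D → ℝ) × (Fin n → ℝ)) :=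
    { toFun := fun v => (fun β => (β : Fin n → ℝ) ⬝ᵥ v - α ⬝ᵥ v, fun i => if i ∈ I then 0 else v i)
      map_add' := fun u v => by
        ext i <;> simp only [dotProduct_add, Prod.fst_add, Prod.snd_add, Pi.add_apply]
        · ring
        · split_ifs <;> simp
      map_smul' := fun c v => by
        ext i <;> simp [dotProduct_smul, mul_sub] }
  obtain ⟨K, hK, hT⟩ := exists_mem_ker_norm_sub_le T
  choose y hy0 hy using fun k => hT (x k)
  have hyD : ∀ k, ∀ β ∈ D, β ⬝ᵥ y k = α ⬝ᵥ y k := fun k β hβ =>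
    sub_eq_zero.1 (congrFun (congrArg Prod.fst (hy0 k)) ⟨β, hβ⟩)
  obtain ⟨B, hB⟩ : ∃ B, ∀ᶠ k in U, ‖T (x k)‖ ≤ B := by
    have h : ∀ β : D, ∃ C, ∀ᶠ k in U, (β : Fin n → ℝ) ⬝ᵥ x k - α ⬝ᵥ x k ≤ C := fun β =>
      (Finset.mem_filter.1 β.2).2
    choose c hc using h
    refine ⟨∑ β, |c β|, ?_⟩
    filter_upwards [hmin, eventually_all.2 hc] with k hk1 hk2
    have hnn : 0 ≤ ∑ β, |c β| := Finset.sum_nonneg fun _ _ => abs_nonneg _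
    rw [Prod.norm_def, max_le_iff]
    constructor
    · refine (pi_norm_le_iff_of_nonneg hnn).2 fun β => ?_
      change ‖(β : Fin n → ℝ) ⬝ᵥ x k - α ⬝ᵥ x k‖ ≤ _
      rw [Real.norm_of_nonneg (sub_nonneg.2 (hk1 _ (Finset.mem_filter.1 β.2).1))]
      exact ((hk2 β).trans (le_abs_self _)).trans
        (Finset.single_le_sum (f := fun β => |c β|) (fun _ _ => abs_nonneg _) (Finset.mem_univ β))
    · refine (pi_norm_le_iff_of_nonneg hnn).2 fun i => ?_
      change ‖if i ∈ I then 0 else x k i‖ ≤ _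
      split_ifs with hi
      · simpa using hnn
      · simpa [hx k i hi] using hnn
  have hxy : ∀ᶠ k in U, ‖x k - y k‖ ≤ K * B := by
    filter_upwards [hB] with k hk
    exact (hy k).trans (mul_le_mul_of_nonneg_left hk hK.le)
  refine ⟨α, hα, y, K * B, hmin, fun k i hi => ?_, hxy, fun β hβ => ?_⟩
  · have := congrFun (congrArg Prod.snd (hy0 k)) i
    change (if i ∈ I then 0 else y k i) = 0 at this
    rwa [if_neg hi] at this
  · by_cases hP : P β
    · exact Or.inl fun k => hyD k β (Finset.mem_filter.2 ⟨hβ, hP⟩)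
    · right
      have h1 := tendsto_atTop_of_not_bounded U hP
      let l : (Fin n → ℝ) →L[ℝ] ℝ := LinearMap.toContinuousLinearMap
        { toFun := fun v => β ⬝ᵥ v - α ⬝ᵥ v
          map_add' := fun u v => by simp only [dotProduct_add]; ring
          map_smul' := fun c v => by simp [dotProduct_smul, mul_sub] }
      -- Passing from `x` to `y` changes the gap by at most `‖l‖ * (K * B)`, so it still tends to
      -- infinity.
      have h2 := tendsto_atTop_add_const_right (U : Filter ι) (-(‖l‖ * (K * B))) h1
      refine tendsto_atTop_mono' _ ?_ h2
      filter_upwards [hxy] with k hk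
      have h2 : l (x k - y k) ≤ ‖l‖ * (K * B) :=
        (le_abs_self _).trans ((l.le_opNorm _).trans
          (mul_le_mul_of_nonneg_left hk (norm_nonneg _)))
      rw [map_sub] at h2
      change (β ⬝ᵥ x k - α ⬝ᵥ x k) - (β ⬝ᵥ y k - α ⬝ᵥ y k) ≤ _ at h2
      linarith

theorem exists_tendsto_of_norm_le {ι E : Type*} [NormedAddCommGroup E] [ProperSpace E]
    (U : Ultrafilter ι) {φ : ι → E} {C : ℝ} (h : ∀ᶠ k in U, ‖φ k‖ ≤ C) :
    ∃ b, Tendsto φ U (𝓝 b) := by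
  obtain ⟨b, _, hb⟩ := (isCompact_closedBall (0 : E) C).ultrafilter_le_nhds (U.map φ)
    (le_principal_iff.2 (h.mono fun k hk => by simpa using hk))
  exact ⟨b, hb⟩

/-! ### Extending weights from `I` to all variables. -/

section Weights

theorem SupportedOn.dotProduct_congr {I : Finset (Fin n)} {m : (Fin n ⊕ Fin n) →₀ ℕ}
    (hm : SupportedOn I m) {v w : Fin n → ℝ} (h : ∀ i ∈ I, v i = w i) :
    radialExp m ⬝ᵥ v = radialExp m ⬝ᵥ w := by
  refine Finset.sum_congr rfl fun i _ => ?_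
  by_cases hi : i ∈ I
  · rw [h i hi]
  · rw [hm i hi, zero_mul, zero_mul]

/-- Exponents are integers, so an exponent leaving `I` picks up at least one full copy of a weight
outside `I`. Large outside weights thus keep such exponents off the face. -/
theorem le_dotProduct_of_not_supportedOn {I : Finset (Fin n)} {m : (Fin n ⊕ Fin n) →₀ ℕ}
    (hm : ¬ SupportedOn I m) {w : Fin n → ℝ} (hw : ∀ i, 0 < w i) {N : ℝ}
    (hN : ∀ i, i ∉ I → N ≤ w i) : N ≤ radialExp m ⬝ᵥ w := by
  simp only [SupportedOn, not_forall] at hm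
  obtain ⟨i, hi, hne⟩ := hm
  have h1 : 1 ≤ radialExp m i := by
    unfold radialExp at hne ⊢
    exact_mod_cast Nat.one_le_iff_ne_zero.2 (by exact_mod_cast hne)
  calc N ≤ w i := hN i hi
    _ ≤ radialExp m i * w i := le_mul_of_one_le_left (hw i).le h1
    _ ≤ radialExp m ⬝ᵥ w := Finset.single_le_sum (f := fun i => radialExp m i * w i)
      (fun j _ => mul_nonneg (radialExp_nonneg m j) (hw j).le) (Finset.mem_univ i)

/-- The weight that agrees with `v` on `I` and is equal to `N` elsewhere. -/
def extendWeight (I : Finset (Fin n)) (v : Fin n → ℝ) (N : ℝ) : Fin n → ℝ :=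
  fun i => if i ∈ I then v i else N

theorem extendWeight_pos {I : Finset (Fin n)} {v : Fin n → ℝ} {N : ℝ} (hv : ∀ i ∈ I, 0 < v i)
    (hN : 0 < N) (i : Fin n) : 0 < extendWeight I v N i := by
  unfold extendWeight
  split_ifs with hi
  exacts [hv i hi, hN]

theorem extendWeight_of_mem {I : Finset (Fin n)} (v : Fin n → ℝ) (N : ℝ) {i : Fin n}
    (hi : i ∈ I) : extendWeight I v N i = v i := if_pos hi

theorem extendWeight_of_notMem {I : Finset (Fin n)} (v : Fin n → ℝ) (N : ℝ) {i : Fin n}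
    (hi : i ∉ I) : extendWeight I v N i = N := if_neg hi

/-- The exponents in the support of a mixed polynomial whose Newton boundary is contained in that
of `g` have weight at least the minimum over the exponents of `g`, for weights on `I`. -/
theorem le_dotProduct_of_supportedOn {f g : MixedPoly n}
    (h : newtonBoundary f ⊆ newtonBoundary g) {I : Finset (Fin n)} {v : Fin n → ℝ}
    (hv : ∀ i ∈ I, 0 < v i) {d : ℝ}
    (hd : ∀ m ∈ g.support, SupportedOn I m → d ≤ radialExp m ⬝ᵥ v)
    {m : (Fin n ⊕ Fin n) →₀ ℕ} (hm : m ∈ f.support) (hmI : SupportedOn I m) :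
    d ≤ radialExp m ⬝ᵥ v := by
  -- The value `|d| + 1` is positive and exceeds `d`, so exponents not supported on `I` satisfy the
  -- bound automatically.
  have hpos := extendWeight_pos (N := |d| + 1) hv (by positivity)
  rw [hmI.dotProduct_congr fun i hi => (extendWeight_of_mem v (|d| + 1) hi).symm]
  refine le_dotProduct_of_newtonBoundary_subset h hpos (fun m' hm' => ?_) hm
  by_cases hI : SupportedOn I m'
  · rw [hI.dotProduct_congr fun i hi => extendWeight_of_mem v (|d| + 1) hi]
    exact hd m' hm' hI
  · exact ((le_abs_self d).trans (by linarith)).trans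
      (le_dotProduct_of_not_supportedOn hI hpos fun i hi =>
        (extendWeight_of_notMem v (|d| + 1) hi).ge)

end Weights

/-! ### Rescaling to a face function. -/

section Blowup

/-- For `i ∈ I` the logarithm of the rescaled modulus is `y k i + log ‖a k i‖`, of absolute value at
most `C`. The coordinate stays in a compact annulus, so its limit is nonzero. -/
theorem exists_tendsto_scaled {ι : Type*} (U : Ultrafilter ι) {I : Finset (Fin n)}
    {a : ι → Cn n} (ha : ∀ᶠ k in U, a k ∈ coordTorus I) {y : ι → Fin n → ℝ} {C : ℝ}
    (hy : ∀ᶠ k in U, ‖(fun i => -Real.log ‖a k i‖) - y k‖ ≤ C) :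
    ∃ b ∈ coordTorus I, Tendsto (fun k => diagMap (fun i => Real.exp (y k i)) (a k)) U (𝓝 b) := by
  have key : ∀ i, ∃ c : ℂ, Tendsto (fun k => (Real.exp (y k i) : ℂ) * a k i) U (𝓝 c) ∧
      (c = 0 ↔ i ∉ I) := by
    intro i
    by_cases hi : i ∈ I
    · have hnorm : ∀ᶠ k in U, Real.exp (-C) ≤ ‖(Real.exp (y k i) : ℂ) * a k i‖ ∧
          ‖(Real.exp (y k i) : ℂ) * a k i‖ ≤ Real.exp C := by
        filter_upwards [ha, hy] with k hk hky
        have hne : a k i ≠ 0 := fun h => (hk i).1 h hi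
        have h1 : |(-Real.log ‖a k i‖) - y k i| ≤ C := (norm_le_pi_norm _ i).trans hky
        rw [abs_le] at h1
        have h2 : ‖(Real.exp (y k i) : ℂ) * a k i‖ = Real.exp (y k i + Real.log ‖a k i‖) := by
          rw [norm_mul, Complex.norm_real, Real.norm_of_nonneg (Real.exp_pos _).le, Real.exp_add,
            Real.exp_log (norm_pos_iff.2 hne)]
        rw [h2]
        exact ⟨Real.exp_le_exp.2 (by linarith), Real.exp_le_exp.2 (by linarith)⟩
      obtain ⟨c, hc⟩ := exists_tendsto_of_norm_le U (hnorm.mono fun k hk => hk.2)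
      refine ⟨c, hc, ?_⟩
      have h3 : Real.exp (-C) ≤ ‖c‖ := ge_of_tendsto hc.norm (hnorm.mono fun k hk => hk.1)
      have h4 : c ≠ 0 := norm_pos_iff.1 ((Real.exp_pos _).trans_le h3)
      simp [h4, hi]
    · refine ⟨0, ?_, by simp [hi]⟩
      refine tendsto_const_nhds.congr' (ha.mono fun k hk => ?_)
      simp only [(hk i).2 hi, mul_zero]
  choose c hc hc0 using key
  refine ⟨WithLp.toLp 2 c, fun i => hc0 i, ?_⟩
  exact ((PiLp.continuous_toLp 2 fun _ : Fin n => ℂ).tendsto c).comp (tendsto_pi_nhds.2 hc)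

/-- After a suitable rescaling, a family of mixed polynomials with constant Newton boundary
converges to a face function of `f₀` along any ultrafilter of points of `ℂ^{*I}` tending to the
origin, and the rescaled points converge in `ℂ^{*I}`. -/
theorem exists_blowup (f : MixedFamily n)
    (h_boundary : ∀ᶠ t in 𝓝 (0 : ℂ), newtonBoundary (f.fiber t) = newtonBoundary (f.fiber 0))
    {I : Finset (Fin n)} (hI : I ∈ nonVanishing (f.fiber 0)) (U : Ultrafilter (ℂ × Cn n))
    (hU : (U : Filter (ℂ × Cn n)) ≤ 𝓝 (0, 0)) (ha : ∀ᶠ p : ℂ × Cn n in U, p.2 ∈ coordTorus I) :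
    ∃ (Δ : Set (Fin n → ℝ)) (w : Fin n → ℝ) (d : ℝ) (y : ℂ × Cn n → Fin n → ℝ)
      (e : ℂ × Cn n → ℝ), IsCompactFace (f.fiber 0) Δ ∧ (∀ i, 0 < w i) ∧
      (∀ m ∈ (f.fiber 0).support, radialExp m ∈ Δ → SupportedOn I m ∧ radialExp m ⬝ᵥ w = d) ∧
      (∃ b ∈ coordTorus I,
        Tendsto (fun p : ℂ × Cn n => diagMap (fun i => Real.exp (y p i)) p.2) U (𝓝 b)) ∧
      ∀ m ∈ f.support, SupportedOn I m →
        Tendsto (fun p : ℂ × Cn n =>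
          (f.coeff m).eval p.1 * (Real.exp (e p - radialExp m ⬝ᵥ y p) : ℂ)) U
          (𝓝 (open Classical in if radialExp m ∈ Δ then (f.coeff m).eval 0 else 0)) := by
  classical
  have ht : Tendsto (fun p : ℂ × Cn n => p.1) U (𝓝 0) := (continuous_fst.tendsto _).mono_left hU
  have hz : Tendsto (fun p : ℂ × Cn n => p.2) U (𝓝 0) := (continuous_snd.tendsto _).mono_left hU
  let x : ℂ × Cn n → Fin n → ℝ := fun p i => if i ∈ I then -Real.log ‖p.2 i‖ else 0
  have hx_eq : ∀ᶠ p in U, x p = fun i => -Real.log ‖p.2 i‖ := by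
    filter_upwards [ha] with p hp
    ext i
    by_cases hi : i ∈ I
    · exact if_pos hi
    -- Off `I` both sides vanish because `Real.log 0 = 0`.
    · simp only [x, if_neg hi, (hp i).2 hi]; simp
  let S : Finset (Fin n → ℝ) := ((f.fiber 0).support.filter (SupportedOn I)).image radialExp
  have hmemS : ∀ m ∈ (f.fiber 0).support, SupportedOn I m → radialExp m ∈ S := fun m hm hmI =>
    Finset.mem_image_of_mem _ (Finset.mem_filter.2 ⟨hm, hmI⟩)
  have hS : S.Nonempty := by
    obtain ⟨m, hm, hmI⟩ := exists_supportedOn_of_mem_nonVanishing hI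
    exact ⟨_, hmemS m hm hmI⟩
  obtain ⟨α, hα, y, C, hmin, hy0, hxy, hface⟩ :=
    exists_asymptotic_face U I hS x fun p i hi => if_neg hi
  obtain ⟨m₀, hm₀, rfl⟩ := Finset.mem_image.1 hα
  obtain ⟨hm₀, hm₀I⟩ := Finset.mem_filter.1 hm₀
  have hxtop : ∀ i ∈ I, Tendsto (fun p => x p i) U atTop := by
    intro i hi
    have h1 : Tendsto (fun p : ℂ × Cn n => ‖p.2 i‖) U (𝓝[>] 0) := by
      refine tendsto_nhdsWithin_iff.2 ⟨?_, ?_⟩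
      · have h2 : Continuous fun z : Cn n => ‖z i‖ := by fun_prop
        simpa [Function.comp_def] using (h2.tendsto 0).comp hz
      · filter_upwards [ha] with p hp
        exact norm_pos_iff.2 fun h => (hp i).1 h hi
    have h3 := tendsto_neg_atBot_atTop.comp (Real.tendsto_log_nhdsGT_zero.comp h1)
    exact h3.congr fun p => (if_pos hi).symm
  have hxpos : ∀ᶠ p in U, ∀ i ∈ I, 0 < x p i :=
    (Finset.eventually_all I).2 fun i hi => (hxtop i hi).eventually_gt_atTop 0
  have hypos : ∀ᶠ p in U, ∀ i ∈ I, 0 < y p i := by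
    refine (Finset.eventually_all I).2 fun i hi => ?_
    filter_upwards [(hxtop i hi).eventually_gt_atTop C, hxy] with p hp hpy
    have := (le_abs_self _).trans ((norm_le_pi_norm (x p - y p) i).trans hpy)
    rw [Pi.sub_apply] at this
    linarith
  have hstrict : ∀ᶠ p in U, ∀ β ∈ S, (∀ k, β ⬝ᵥ y k = radialExp m₀ ⬝ᵥ y k) ∨
      radialExp m₀ ⬝ᵥ y p < β ⬝ᵥ y p := by
    refine (Finset.eventually_all S).2 fun β hβ => ?_
    rcases hface β hβ with h | h
    · exact Eventually.of_forall fun p => Or.inl h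
    · filter_upwards [h.eventually_gt_atTop 0] with p hp
      exact Or.inr (sub_pos.1 hp)
  -- One value of `y` suffices to define the face: at `k` it is positive on `I`, and every exponent
  -- of `S` not permanently tied with `m₀` is strictly heavier.
  obtain ⟨k, hk1, hk2⟩ := (hypos.and hstrict).exists
  set d := radialExp m₀ ⬝ᵥ y k with hd
  set w := extendWeight I (y k) (|d| + 1) with hw
  have hwpos : ∀ i, 0 < w i := extendWeight_pos hk1 (by positivity)
  have hwI : ∀ m, SupportedOn I m → radialExp m ⬝ᵥ w = radialExp m ⬝ᵥ y k := fun m hm =>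
    hm.dotProduct_congr fun i hi => extendWeight_of_mem _ _ hi
  have hwN : ∀ m, ¬ SupportedOn I m → d < radialExp m ⬝ᵥ w := fun m hm =>
    lt_of_lt_of_le (by linarith [le_abs_self d]) (le_dotProduct_of_not_supportedOn hm hwpos
      fun i hi => (extendWeight_of_notMem (y k) (|d| + 1) hi).ge)
  have hwd : ∀ m ∈ (f.fiber 0).support, d ≤ radialExp m ⬝ᵥ w := by
    intro m hm
    by_cases hmI : SupportedOn I m
    · rw [hwI m hmI]
      rcases hk2 _ (hmemS m hm hmI) with h | h
      exacts [(h k).ge, h.le]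
    · exact (hwN m hmI).le
  refine ⟨{ξ ∈ newtonPolygon (f.fiber 0) | ξ ⬝ᵥ w = d}, w, d, y, fun p => radialExp m₀ ⬝ᵥ y p,
    isCompactFace_of_pos hwpos hwd hm₀ (hwI m₀ hm₀I), hwpos, fun m hm hmΔ => ⟨?_, hmΔ.2⟩,
    exists_tendsto_scaled U ha (C := C) ?_, ?_⟩
  · by_contra hmI
    exact (hwN m hmI).ne' hmΔ.2
  · filter_upwards [hxy, hx_eq] with p hp hpx
    rwa [← hpx]
  · intro m hmf hmI
    have hcoeff : Tendsto (fun p : ℂ × Cn n => (f.coeff m).eval p.1) U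
        (𝓝 ((f.coeff m).eval 0)) := ((f.coeff m).continuous.tendsto 0).comp ht
    -- A monomial absent at `t = 0` may appear for `t ≠ 0`. The constant Newton boundary then makes
    -- it no lighter than `m₀` for `x`, so its scaling factor is at most `exp (‖l‖ * C)`.
    by_cases h0 : (f.coeff m).eval 0 = 0
    · rw [h0, ite_self]
      rw [h0] at hcoeff
      let l : (Fin n → ℝ) →L[ℝ] ℝ := LinearMap.toContinuousLinearMap
        { toFun := fun v => radialExp m ⬝ᵥ v - radialExp m₀ ⬝ᵥ v
          map_add' := fun u v => by simp only [dotProduct_add]; ring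
          map_smul' := fun c v => by simp [dotProduct_smul, mul_sub] }
      have hlim := hcoeff.norm.mul_const (Real.exp (‖l‖ * C))
      rw [norm_zero, zero_mul] at hlim
      refine squeeze_zero_norm' ?_ hlim
      filter_upwards [hmin, hxy, hxpos, ht.eventually h_boundary] with p hp1 hp2 hp3 hp4
      by_cases hpm : (f.coeff m).eval p.1 = 0
      · simp [hpm]
      · have hsupp : m ∈ (f.fiber p.1).support := by
          rwa [MvPolynomial.mem_support_iff, coeff_fiber]
        have h1 : radialExp m₀ ⬝ᵥ x p ≤ radialExp m ⬝ᵥ x p :=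
          le_dotProduct_of_supportedOn hp4.le hp3
            (fun m' hm' hmI' => hp1 _ (hmemS m' hm' hmI')) hsupp hmI
        have h2 : l (x p - y p) ≤ ‖l‖ * C :=
          (le_abs_self _).trans ((l.le_opNorm _).trans
            (mul_le_mul_of_nonneg_left hp2 (norm_nonneg _)))
        rw [map_sub] at h2
        change (radialExp m ⬝ᵥ x p - radialExp m₀ ⬝ᵥ x p) -
          (radialExp m ⬝ᵥ y p - radialExp m₀ ⬝ᵥ y p) ≤ _ at h2
        rw [norm_mul, Complex.norm_real, Real.norm_of_nonneg (Real.exp_pos _).le]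
        exact mul_le_mul_of_nonneg_left (Real.exp_le_exp.2 (by linarith)) (norm_nonneg _)
    · have hsupp : m ∈ (f.fiber 0).support := by
        rwa [MvPolynomial.mem_support_iff, coeff_fiber]
      rcases hface _ (hmemS m hsupp hmI) with h | h
      · rw [if_pos ⟨radialExp_mem_newtonPolygon hsupp, (hwI m hmI).trans (h k)⟩]
        refine hcoeff.congr fun p => ?_
        rw [h p, sub_self, Real.exp_zero, Complex.ofReal_one, mul_one]
      · have hne : ¬ (radialExp m ∈ {ξ ∈ newtonPolygon (f.fiber 0) | ξ ⬝ᵥ w = d}) := by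
          rintro ⟨-, hmd⟩
          rw [hwI m hmI] at hmd
          rcases hk2 _ (hmemS m hsupp hmI) with h' | h'
          · obtain ⟨p, hp⟩ := (h.eventually_gt_atTop 0).exists
            rw [h' p, sub_self] at hp
            exact lt_irrefl _ hp
          · exact h'.ne' hmd
        rw [if_neg hne]
        have h1 : Tendsto (fun p => Real.exp (radialExp m₀ ⬝ᵥ y p - radialExp m ⬝ᵥ y p)) U
            (𝓝 0) := (Real.tendsto_exp_neg_atTop_nhds_zero.comp h).congr fun p => by
              simp only [Function.comp, neg_sub]
        have h2 := hcoeff.mul ((Complex.continuous_ofReal.tendsto 0).comp h1)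
        rwa [Complex.ofReal_zero, mul_zero] at h2

end Blowup

/-! ### Derivatives of monomials under scalings and projections. -/

section Derivative

theorem fderiv_sum_mixedMonomial (s : Finset ((Fin n ⊕ Fin n) →₀ ℕ))
    (c : ((Fin n ⊕ Fin n) →₀ ℕ) → ℂ) (z v : Cn n) :
    fderiv ℝ (fun u : Cn n => ∑ m ∈ s, c m * mixedMonomial m u) z v =
      ∑ m ∈ s, c m * fderiv ℝ (mixedMonomial m) z v := by
  have h : HasFDerivAt (fun u : Cn n => ∑ m ∈ s, c m * mixedMonomial m u)
      (∑ m ∈ s, c m • fderiv ℝ (mixedMonomial m) z) z :=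
    HasFDerivAt.fun_sum fun m _ =>
      ((differentiable_mixedMonomial m z).hasFDerivAt).const_mul (c m)
  rw [h.fderiv]
  simp

theorem fderiv_comp_clm {F : Cn n → ℂ} (hF : Differentiable ℝ F) (L : Cn n →L[ℝ] Cn n)
    (z v : Cn n) : fderiv ℝ (fun u => F (L u)) z v = fderiv ℝ F (L z) (L v) :=
  congrArg (fun l => l v) ((hF (L z)).hasFDerivAt.comp z L.hasFDerivAt).fderiv

theorem fderiv_mixedMonomial_diagMap_exp (m : (Fin n ⊕ Fin n) →₀ ℕ) (w : Fin n → ℝ) (z v : Cn n) :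
    fderiv ℝ (mixedMonomial m) (diagMap (fun i => Real.exp (w i)) z)
        (diagMap (fun i => Real.exp (w i)) v) =
      (Real.exp (radialExp m ⬝ᵥ w) : ℂ) * fderiv ℝ (mixedMonomial m) z v := by
  rw [← fderiv_comp_clm (differentiable_mixedMonomial m)]
  have h : (fun u : Cn n => mixedMonomial m (diagMap (fun i => Real.exp (w i)) u)) =
      fun u => (Real.exp (radialExp m ⬝ᵥ w) : ℂ) * mixedMonomial m u :=
    funext fun u => mixedMonomial_diagMap_exp m w u
  rw [h, (((differentiable_mixedMonomial m z).hasFDerivAt).const_mul _).fderiv]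
  simp

/-- The projection onto `ℂ^I`. -/
def coordProj (I : Finset (Fin n)) : Cn n →L[ℝ] Cn n := diagMap fun i => if i ∈ I then 1 else 0

theorem coordProj_apply_of_mem {I : Finset (Fin n)} {i : Fin n} (hi : i ∈ I) (v : Cn n) :
    coordProj I v i = v i := by simp [coordProj, hi]

theorem coordProj_mem (I : Finset (Fin n)) (v : Cn n) : coordProj I v ∈ coordSubspace I :=
  fun i hi => by simp [coordProj, hi]

theorem coordProj_of_mem {I : Finset (Fin n)} {v : Cn n} (hv : v ∈ coordSubspace I) :
    coordProj I v = v := by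
  ext i
  by_cases hi : i ∈ I
  · exact coordProj_apply_of_mem hi v
  · rw [coordProj_mem I v i hi, hv i hi]

theorem fderiv_mixedMonomial_of_supportedOn {I : Finset (Fin n)} {m : (Fin n ⊕ Fin n) →₀ ℕ}
    (hm : SupportedOn I m) (z v : Cn n) :
    fderiv ℝ (mixedMonomial m) z v =
      fderiv ℝ (mixedMonomial m) (coordProj I z) (coordProj I v) := by
  rw [← fderiv_comp_clm (differentiable_mixedMonomial m)]
  congr 2
  ext u
  exact mixedMonomial_congr hm fun i hi => (coordProj_apply_of_mem hi u).symm

theorem fderiv_mixedMonomial_of_not_supportedOn {I : Finset (Fin n)}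
    {m : (Fin n ⊕ Fin n) →₀ ℕ} (hm : ¬ SupportedOn I m) {z v : Cn n}
    (hz : z ∈ coordSubspace I) (hv : v ∈ coordSubspace I) :
    fderiv ℝ (mixedMonomial m) z v = 0 := by
  rw [← coordProj_of_mem hz, ← coordProj_of_mem hv,
    ← fderiv_comp_clm (differentiable_mixedMonomial m)]
  have h : (fun u : Cn n => mixedMonomial m (coordProj I u)) = fun _ => 0 :=
    funext fun u => mixedMonomial_eq_zero hm (coordProj_mem I u)
  rw [h, fderiv_fun_const]
  rfl

/-- Euler's identity for the radial weighted homogeneity of a monomial. -/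
theorem fderiv_mixedMonomial_euler (m : (Fin n ⊕ Fin n) →₀ ℕ) (w : Fin n → ℝ) (z : Cn n) :
    fderiv ℝ (mixedMonomial m) z (diagMap w z) =
      ((radialExp m ⬝ᵥ w : ℝ) : ℂ) * mixedMonomial m z := by
  let L : (Fin n → ℝ) →L[ℝ] Cn n := LinearMap.toContinuousLinearMap
    { toFun := fun c => diagMap c z
      map_add' := fun c c' => by ext i; simp [add_mul]
      map_smul' := fun r c => by ext i; simp [mul_assoc] }
  have hexp : ∀ c : ℝ, HasDerivAt (fun s : ℝ => Real.exp (s * c)) c 0 := fun c => by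
    have := ((hasDerivAt_id (0 : ℝ)).mul_const c).exp
    simpa using this
  have hc : HasDerivAt (fun s : ℝ => fun i => Real.exp (s * w i)) w 0 :=
    hasDerivAt_pi.2 fun i => hexp (w i)
  -- Euler's identity is the homogeneity relation differentiated at `s = 0` along the curve `exp (s
  -- w) z`.
  have hcurve : HasDerivAt (fun s : ℝ => diagMap (fun i => Real.exp (s * w i)) z)
      (diagMap w z) 0 := L.hasFDerivAt.comp_hasDerivAt (0 : ℝ) hc
  have h0 : diagMap (fun i => Real.exp ((0 : ℝ) * w i)) z = z := by ext i; simp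
  have h1 : HasDerivAt
      (fun s : ℝ => mixedMonomial m (diagMap (fun i => Real.exp (s * w i)) z))
      (fderiv ℝ (mixedMonomial m) z (diagMap w z)) 0 := by
    have hm : HasFDerivAt (mixedMonomial m) (fderiv ℝ (mixedMonomial m) z)
        (diagMap (fun i => Real.exp ((0 : ℝ) * w i)) z) := by
      rw [h0]; exact (differentiable_mixedMonomial m z).hasFDerivAt
    exact hm.comp_hasDerivAt (0 : ℝ) hcurve
  have h2 : HasDerivAt
      (fun s : ℝ => mixedMonomial m (diagMap (fun i => Real.exp (s * w i)) z))
      (((radialExp m ⬝ᵥ w : ℝ) : ℂ) * mixedMonomial m z) 0 := by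
    have h3 : (fun s : ℝ => mixedMonomial m (diagMap (fun i => Real.exp (s * w i)) z)) =
        fun s : ℝ => (Real.exp (s * (radialExp m ⬝ᵥ w)) : ℂ) * mixedMonomial m z := by
      ext s
      have := mixedMonomial_diagMap_exp m (s • w) z
      rwa [dotProduct_smul] at this
    rw [h3]
    exact ((hexp _).ofReal_comp).mul_const _
  exact h1.unique h2

theorem tendsto_fderiv_mixedMonomial {ι : Type*} {l : Filter ι} {b : ι → Cn n} {b₀ : Cn n}
    (hb : Tendsto b l (𝓝 b₀)) (m : (Fin n ⊕ Fin n) →₀ ℕ) (v : Cn n) :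
    Tendsto (fun k => fderiv ℝ (mixedMonomial m) (b k) v) l
      (𝓝 (fderiv ℝ (mixedMonomial m) b₀ v)) := by
  have h : Continuous fun z : Cn n => fderiv ℝ (mixedMonomial m) z v :=
    ((contDiff_mixedMonomial m).continuous_fderiv one_ne_zero).clm_apply continuous_const
  exact (h.tendsto b₀).comp hb

end Derivative

/-! ### Limits of linear relations. -/

section Normalize

/-- A family of nontrivial linear relations between three real functions has a nontrivial limit
relation along an ultrafilter. -/
theorem exists_limit_relation {ι V : Type*} (U : Ultrafilter ι) {A B D : ι → V → ℝ}
    {A₀ B₀ D₀ : V → ℝ} (hA : ∀ v, Tendsto (fun k => A k v) U (𝓝 (A₀ v)))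
    (hB : ∀ v, Tendsto (fun k => B k v) U (𝓝 (B₀ v)))
    (hD : ∀ v, Tendsto (fun k => D k v) U (𝓝 (D₀ v)))
    (h : ∀ᶠ k in U, ∃ c : ℝ × ℝ × ℝ, c ≠ 0 ∧
      ∀ v, c.1 * A k v + c.2.1 * B k v + c.2.2 * D k v = 0) :
    ∃ c : ℝ × ℝ × ℝ, c ≠ 0 ∧ ∀ v, c.1 * A₀ v + c.2.1 * B₀ v + c.2.2 * D₀ v = 0 := by
  -- Unit norm gives compactness and keeps the limit relation nontrivial.
  have h' : ∀ᶠ k in U, ∃ c : ℝ × ℝ × ℝ, ‖c‖ = 1 ∧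
      ∀ v, c.1 * A k v + c.2.1 * B k v + c.2.2 * D k v = 0 := by
    filter_upwards [h] with k ⟨c, hc, hk⟩
    refine ⟨‖c‖⁻¹ • c, ?_, fun v => ?_⟩
    · rw [norm_smul, norm_inv, norm_norm, inv_mul_cancel₀ (norm_ne_zero_iff.2 hc)]
    · simp only [Prod.smul_fst, Prod.smul_snd, smul_eq_mul]
      linear_combination ‖c‖⁻¹ * hk v
  obtain ⟨c, hc⟩ := h'.choice
  obtain ⟨c₀, hc₀⟩ := exists_tendsto_of_norm_le U (hc.mono fun k hk => hk.1.le)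
  refine ⟨c₀, ?_, fun v => ?_⟩
  · have h1 : Tendsto (fun k => ‖c k‖) U (𝓝 1) :=
      tendsto_const_nhds.congr' (hc.mono fun k hk => hk.1.symm)
    exact norm_ne_zero_iff.1 (by rw [tendsto_nhds_unique hc₀.norm h1]; exact one_ne_zero)
  · have h1 := (continuous_fst.tendsto c₀).comp hc₀
    have h2 := (continuous_fst.comp continuous_snd).tendsto c₀ |>.comp hc₀
    have h3 := (continuous_snd.comp continuous_snd).tendsto c₀ |>.comp hc₀
    exact tendsto_nhds_unique
      (((h1.mul (hA v)).add (h2.mul (hB v))).add (h3.mul (hD v)))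
      (tendsto_const_nhds.congr' (hc.mono fun k hk => (hk.2 v).symm))

end Normalize

/-! ### Independence of the differentials near the origin. -/

section Independence

/-- The real differentials of `Re F`, `Im F` and of half the squared distance to the origin are
linearly independent on `ℂ^I` at `a`. -/
def RadiallyIndependent (F : Cn n → ℂ) (I : Finset (Fin n)) (a : Cn n) : Prop :=
  ∀ c : ℝ × ℝ × ℝ, (∀ v ∈ coordSubspace I, c.1 * (fderiv ℝ F a v).re +
    c.2.1 * (fderiv ℝ F a v).im + c.2.2 * (inner ℂ a v).re = 0) → c = 0

theorem coordTorus_subset (I : Finset (Fin n)) {a : Cn n} (ha : a ∈ coordTorus I) :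
    a ∈ coordSubspace I := fun i hi => (ha i).2 hi

/-- In the rescaled coordinates the radial functional becomes a sum with positive weights `exp (-2 y
i)`, which can be normalized to total mass one. -/
theorem inner_diagMap_exp_neg {I : Finset (Fin n)} (y : Fin n → ℝ) {a v : Cn n}
    (ha : a ∈ coordSubspace I) :
    (inner ℂ a (diagMap (fun i => Real.exp (-y i)) v)).re =
      ∑ i ∈ I, Real.exp (-(2 * y i)) *
        (v i * (starRingEnd ℂ) (diagMap (fun i => Real.exp (y i)) a i)).re := by
  rw [PiLp.inner_apply, Complex.re_sum]
  rw [← Finset.sum_subset (Finset.subset_univ I)]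
  · refine Finset.sum_congr rfl fun i _ => ?_
    have h : Real.exp (-(2 * y i)) * Real.exp (y i) = Real.exp (-y i) := by
      rw [← Real.exp_add]; congr 1; ring
    simp only [RCLike.inner_apply, diagMap_apply, map_mul, Complex.conj_ofReal]
    rw [← Complex.re_ofReal_mul, ← h]
    congr 1
    push_cast
    ring
  · intro i _ hi
    simp [ha i hi]

/-- If the face functions have no critical points on the torus, then near the origin the zero
points on `ℂ^{*I}` of the members of the family are non-singular and transverse to the spheres. -/
theorem eventually_radiallyIndependent (f : MixedFamily n)
    (h_zero : (0 : Cn n) ∈ hypersurface (f.fiber 0))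
    (h_boundary : ∀ᶠ t in 𝓝 (0 : ℂ), newtonBoundary (f.fiber t) = newtonBoundary (f.fiber 0))
    (h_nondeg : StronglyNonDegenerate (f.fiber 0))
    {I : Finset (Fin n)} (hI : I ∈ nonVanishing (f.fiber 0)) :
    ∀ᶠ p in 𝓝 ((0 : ℂ), (0 : Cn n)), p.2 ∈ hypersurface (f.fiber p.1) → p.2 ∈ coordTorus I →
      RadiallyIndependent (f.fiber p.1).fn I p.2 := by
  classical
  -- The empty set is excluded by `f_0(0) = 0`; nonemptiness makes the normalizing mass `M`
  -- positive.
  have hIne : I.Nonempty := by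
    rw [Finset.nonempty_iff_ne_empty]
    rintro rfl
    obtain ⟨z, hz⟩ := hI
    have : (z : Cn n) = 0 := by ext i; exact z.2 i (Finset.notMem_empty i)
    exact hz (by rw [MixedPoly.restrictFn, this]; exact h_zero)
  by_contra hcon
  have hneBot : (𝓝 ((0 : ℂ), (0 : Cn n)) ⊓ 𝓟 {p | ¬ (p.2 ∈ hypersurface (f.fiber p.1) →
      p.2 ∈ coordTorus I → RadiallyIndependent (f.fiber p.1).fn I p.2)}).NeBot :=
    frequently_mem_iff_neBot.1 (not_eventually.1 hcon)
  obtain ⟨U, hUle⟩ := Ultrafilter.exists_le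
    (𝓝 ((0 : ℂ), (0 : Cn n)) ⊓ 𝓟 {p | ¬ (p.2 ∈ hypersurface (f.fiber p.1) →
      p.2 ∈ coordTorus I → RadiallyIndependent (f.fiber p.1).fn I p.2)})
  have hbad : ∀ᶠ p : ℂ × Cn n in U, p.2 ∈ hypersurface (f.fiber p.1) ∧ p.2 ∈ coordTorus I ∧
      ¬ RadiallyIndependent (f.fiber p.1).fn I p.2 := by
    filter_upwards [le_principal_iff.1 (hUle.trans inf_le_right)] with p hp
    simpa only [Set.mem_ofPred_eq, Classical.not_imp] using hp
  have htorus : ∀ᶠ p : ℂ × Cn n in U, p.2 ∈ coordTorus I := hbad.mono fun p hp => hp.2.1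
  obtain ⟨Δ, w, d, y, e, hΔ, hw, hΔw, ⟨b, hb, hbt⟩, hcoef⟩ :=
    exists_blowup f h_boundary hI U (hUle.trans inf_le_left) htorus
  let E : ℂ × Cn n → Cn n →L[ℝ] Cn n := fun p => diagMap fun i => Real.exp (y p i)
  let E' : ℂ × Cn n → Cn n →L[ℝ] Cn n := fun p => diagMap fun i => Real.exp (-y p i)
  have hE'E : ∀ p v, E' p (E p v) = v := fun p v => by
    ext i
    simp only [E, E', diagMap_apply]
    rw [← mul_assoc, ← Complex.ofReal_mul, ← Real.exp_add, neg_add_cancel, Real.exp_zero,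
      Complex.ofReal_one, one_mul]
  let s := f.support.filter (SupportedOn I)
  let c : ℂ × Cn n → ((Fin n ⊕ Fin n) →₀ ℕ) → ℂ := fun p m =>
    (f.coeff m).eval p.1 * (Real.exp (e p - radialExp m ⬝ᵥ y p) : ℂ)
  let c₀ : ((Fin n ⊕ Fin n) →₀ ℕ) → ℂ := fun m => if radialExp m ∈ Δ then (f.coeff m).eval 0 else 0
  have hc : ∀ m ∈ s, Tendsto (fun p => c p m) U (𝓝 (c₀ m)) := fun m hm =>
    hcoef m (Finset.mem_filter.1 hm).1 (Finset.mem_filter.1 hm).2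
  have hface : (facePoly (f.fiber 0) Δ).fn = fun u => ∑ m ∈ s, c₀ m * mixedMonomial m u := by
    ext u
    rw [facePoly_fn, Finset.sum_filter]
    have h1 : ∀ m, (if radialExp m ∈ Δ then (f.fiber 0).coeff m * mixedMonomial m u else 0) =
        c₀ m * mixedMonomial m u := fun m => by
      rw [coeff_fiber, ← ite_zero_mul]
    simp only [h1]
    rw [← Finset.sum_filter_of_ne (p := SupportedOn I)]
    · refine Finset.sum_subset
        (Finset.filter_subset_filter _ (MvPolynomial.support_map_subset _ _)) fun m hm hm' => ?_
      have h2 : m ∉ (f.fiber 0).support := fun h =>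
        hm' (Finset.mem_filter.2 ⟨h, (Finset.mem_filter.1 hm).2⟩)
      rw [MvPolynomial.notMem_support_iff, coeff_fiber] at h2
      simp only [c₀, h2, ite_self, zero_mul]
    · intro m hm hne
      by_cases hmΔ : radialExp m ∈ Δ
      · exact (hΔw m hm hmΔ).1
      · simp [c₀, hmΔ] at hne
  have hc₀w : ∀ m, c₀ m * ((radialExp m ⬝ᵥ w : ℝ) : ℂ) = c₀ m * d := by
    intro m
    by_cases h1 : c₀ m = 0
    · rw [h1, zero_mul, zero_mul]
    · have hmΔ : radialExp m ∈ Δ := by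
        by_contra h2
        exact h1 (if_neg h2)
      have h2 : m ∈ (f.fiber 0).support := by
        rw [MvPolynomial.mem_support_iff, coeff_fiber]
        simpa [c₀, hmΔ] using h1
      rw [(hΔw m h2 hmΔ).2]
  set g : Cn n → ℂ := (facePoly (f.fiber 0) Δ).fn with hg
  -- the limit point is a zero of the face function
  have hgb : g b = 0 := by
    have h1 : Tendsto (fun p : ℂ × Cn n => ∑ m ∈ s, c p m * mixedMonomial m (E p p.2)) U
        (𝓝 (∑ m ∈ s, c₀ m * mixedMonomial m b)) :=
      tendsto_finsetSum _ fun m hm => (hc m hm).mul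
        (((contDiff_mixedMonomial m).continuous.tendsto b).comp hbt)
    rw [hface]
    refine tendsto_nhds_unique h1 (tendsto_const_nhds.congr' ?_)
    filter_upwards [hbad] with p hp
    have h2 : (f.fiber p.1).fn p.2 = 0 := hp.1
    rw [fiber_fn, ← Finset.sum_filter_of_ne (p := SupportedOn I)] at h2
    · calc (0 : ℂ) = (Real.exp (e p) : ℂ) *
          ∑ m ∈ s, (f.coeff m).eval p.1 * mixedMonomial m p.2 := by rw [h2, mul_zero]
        _ = _ := by
          rw [Finset.mul_sum]
          refine Finset.sum_congr rfl fun m _ => ?_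
          simp only [E, c, mixedMonomial_diagMap_exp, Real.exp_sub, Complex.ofReal_div]
          have := Complex.ofReal_ne_zero.2 (Real.exp_pos (radialExp m ⬝ᵥ y p)).ne'
          field_simp
    · intro m _ hne
      by_contra hmI
      exact hne (by rw [mixedMonomial_eq_zero hmI (coordTorus_subset I hp.2.1), mul_zero])
  have hgd : ∀ v, fderiv ℝ g b v = ∑ m ∈ s, c₀ m * fderiv ℝ (mixedMonomial m) b v := fun v => by
    rw [hface]; exact fderiv_sum_mixedMonomial s c₀ b v
  have heuler : fderiv ℝ g b (diagMap w b) = 0 := by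
    rw [hgd]
    have h1 : ∑ m ∈ s, c₀ m * mixedMonomial m b = 0 := by
      rw [← hgb, hface]
    calc ∑ m ∈ s, c₀ m * fderiv ℝ (mixedMonomial m) b (diagMap w b) =
          ∑ m ∈ s, d * (c₀ m * mixedMonomial m b) :=
          Finset.sum_congr rfl fun m _ => by
            rw [fderiv_mixedMonomial_euler, ← mul_assoc, hc₀w]; ring
      _ = 0 := by rw [← Finset.mul_sum, h1, mul_zero]
  -- the differential of the rescaled functions
  let P : ℂ × Cn n → Cn n → ℂ := fun p v =>
    ∑ m ∈ s, c p m * fderiv ℝ (mixedMonomial m) (E p p.2) v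
  have hPlim : ∀ v, Tendsto (fun p => P p v) U (𝓝 (fderiv ℝ g b v)) := fun v => by
    rw [hgd]
    exact tendsto_finsetSum _ fun m hm => (hc m hm).mul (tendsto_fderiv_mixedMonomial hbt m v)
  have hP : ∀ p : ℂ × Cn n, p.2 ∈ coordTorus I → ∀ v ∈ coordSubspace I,
      (Real.exp (e p) : ℂ) * fderiv ℝ (f.fiber p.1).fn p.2 (E' p v) = P p v := by
    intro p hp v hv
    have hp' := coordTorus_subset I hp
    rw [show (f.fiber p.1).fn = _ from funext (fiber_fn f p.1), fderiv_sum_mixedMonomial,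
      ← Finset.sum_filter_of_ne (p := SupportedOn I), Finset.mul_sum]
    · refine Finset.sum_congr rfl fun m _ => ?_
      have h1 := fderiv_mixedMonomial_diagMap_exp m (-y p) (E p p.2) v
      have h2 : fderiv ℝ (mixedMonomial m) p.2 (E' p v) =
          (Real.exp (radialExp m ⬝ᵥ -y p) : ℂ) * fderiv ℝ (mixedMonomial m) (E p p.2) v := by
        rw [← h1]
        exact congrArg (fun z => fderiv ℝ (mixedMonomial m) z (E' p v)) (hE'E p p.2).symm
      simp only [c]
      rw [h2, sub_eq_add_neg, Real.exp_add, dotProduct_neg, Complex.ofReal_mul]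
      ring
    · intro m _ hne
      by_contra hmI
      exact hne (by
        rw [fderiv_mixedMonomial_of_not_supportedOn hmI hp' (diagMap_mem _ hv), mul_zero])
  -- the rescaled radial functionals
  let M : ℂ × Cn n → ℝ := fun p => ∑ i ∈ I, Real.exp (-(2 * y p i))
  have hM : ∀ p, 0 < M p := fun p => Finset.sum_pos (fun i _ => Real.exp_pos _) hIne
  -- Dividing by `M` yields probability weights on `I`, whose limit still has total mass one, so the
  -- limit radial functional does not degenerate.
  let θ : ℂ × Cn n → Fin n → ℝ := fun p i => if i ∈ I then Real.exp (-(2 * y p i)) / M p else 0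
  have hθ0 : ∀ p i, 0 ≤ θ p i := fun p i => by
    simp only [θ]
    split_ifs
    exacts [div_nonneg (Real.exp_pos _).le (hM p).le, le_rfl]
  have hθsum : ∀ p, ∑ i ∈ I, θ p i = 1 := fun p => by
    rw [Finset.sum_congr rfl fun i hi => if_pos hi, ← Finset.sum_div]
    exact div_self (hM p).ne'
  obtain ⟨θ₀, hθ₀⟩ : ∃ θ₀, Tendsto θ U (𝓝 θ₀) := by
    refine exists_tendsto_of_norm_le U (C := 1) (Eventually.of_forall fun p => ?_)
    refine (pi_norm_le_iff_of_nonneg zero_le_one).2 fun i => ?_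
    rw [Real.norm_of_nonneg (hθ0 p i)]
    by_cases hi : i ∈ I
    · rw [← hθsum p]
      exact Finset.single_le_sum (fun j _ => hθ0 p j) hi
    · simp [θ, hi]
  have hθ₀i : ∀ i, Tendsto (fun p => θ p i) U (𝓝 (θ₀ i)) := fun i => tendsto_pi_nhds.1 hθ₀ i
  have hθ₀0 : ∀ i, 0 ≤ θ₀ i := fun i =>
    ge_of_tendsto (hθ₀i i) (Eventually.of_forall fun p => hθ0 p i)
  have hθ₀sum : ∑ i ∈ I, θ₀ i = 1 :=
    tendsto_nhds_unique (tendsto_finsetSum I fun i _ => hθ₀i i)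
      (tendsto_const_nhds.congr fun p => (hθsum p).symm)
  have hbi : ∀ i, Tendsto (fun p => E p p.2 i) U (𝓝 (b i)) := fun i => by
    have h1 : Continuous fun z : Cn n => z i := by fun_prop
    exact (h1.tendsto b).comp hbt
  obtain ⟨c₁, hc₁, hrel⟩ := exists_limit_relation (V := coordSubspace I) U
    (A := fun p v => (P p v).re) (B := fun p v => (P p v).im)
    (D := fun p v => ∑ i ∈ I, θ p i * ((v : Cn n) i * (starRingEnd ℂ) (E p p.2 i)).re)
    (A₀ := fun v => (fderiv ℝ g b v).re) (B₀ := fun v => (fderiv ℝ g b v).im)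
    (D₀ := fun v => ∑ i ∈ I, θ₀ i * ((v : Cn n) i * (starRingEnd ℂ) (b i)).re)
    (fun v => (Complex.continuous_re.tendsto _).comp (hPlim v))
    (fun v => (Complex.continuous_im.tendsto _).comp (hPlim v))
    (fun v => tendsto_finsetSum _ fun i _ => (hθ₀i i).mul
      ((Complex.continuous_re.tendsto _).comp
        (tendsto_const_nhds.mul ((Complex.continuous_conj.tendsto _).comp (hbi i)))))
    (by
      filter_upwards [hbad] with p ⟨_, hp, hp'⟩
      simp only [RadiallyIndependent, not_forall] at hp'
      obtain ⟨k, hk, hk0⟩ := hp'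
      -- `P` carries the factor `exp (e p)` and the normalized radial functional carries `1 / M p`;
      -- the third coefficient compensates for both.
      refine ⟨(k.1, k.2.1, k.2.2 * (Real.exp (e p) * M p)), fun h => hk0 ?_, fun v => ?_⟩
      · have h1 := congrArg Prod.fst h
        have h2 := congrArg (fun q => q.2.1) h
        have h3 := congrArg (fun q => q.2.2) h
        simp only [Prod.fst_zero, Prod.snd_zero] at h1 h2 h3
        have h4 := (mul_eq_zero.1 h3).resolve_right
          (mul_pos (Real.exp_pos _) (hM p)).ne'
        exact Prod.ext h1 (Prod.ext h2 h4)
      · have h1 := hk (E' p v) (diagMap_mem _ v.2)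
        have h2 := hP p hp v v.2
        have h3 := inner_diagMap_exp_neg (y p) (v := v) (coordTorus_subset I hp)
        have h4 : M p * ∑ i ∈ I, θ p i * ((v : Cn n) i * (starRingEnd ℂ) (E p p.2 i)).re =
            (inner ℂ p.2 (E' p v)).re := by
          rw [h3, Finset.mul_sum]
          refine Finset.sum_congr rfl fun i hi => ?_
          simp only [θ, if_pos hi]
          have := (hM p).ne'
          field_simp
          rfl
        rw [← h2, Complex.re_ofReal_mul, Complex.im_ofReal_mul]
        linear_combination Real.exp (e p) * h1 + k.2.2 * Real.exp (e p) * h4)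
  -- Test the limit relation on `w b`: Euler's identity kills both `dg` terms, and what remains is
  -- `∑ θ₀ i * w i * |b i|²`, which is positive.
  have hσ : c₁.2.2 = 0 := by
    have h1 := hrel ⟨diagMap w b, diagMap_mem w (coordTorus_subset I hb)⟩
    simp only [heuler, Complex.zero_re, Complex.zero_im, mul_zero, zero_add] at h1
    refine (mul_eq_zero.1 h1).resolve_right (ne_of_gt ?_)
    have hterm : ∀ i, θ₀ i * (diagMap w b i * (starRingEnd ℂ) (b i)).re =
        θ₀ i * (w i * Complex.normSq (b i)) := fun i => by
      rw [diagMap_apply, mul_assoc, Complex.mul_conj, ← Complex.ofReal_mul, Complex.ofReal_re]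
    simp only [hterm]
    obtain ⟨i, hi, hne⟩ : ∃ i ∈ I, θ₀ i ≠ 0 := by
      by_contra! h
      rw [Finset.sum_eq_zero h] at hθ₀sum
      exact zero_ne_one hθ₀sum
    have hbne : b i ≠ 0 := fun h => (hb i).1 h hi
    refine Finset.sum_pos' (fun j _ => mul_nonneg (hθ₀0 j)
      (mul_nonneg (hw j).le (Complex.normSq_nonneg _))) ⟨i, hi, ?_⟩
    exact mul_pos (lt_of_le_of_ne (hθ₀0 i) hne.symm) (mul_pos (hw i) (Complex.normSq_pos.2 hbne))
  -- a critical point of the face function on the torus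
  let z : Cn n := WithLp.toLp 2 fun i => if i ∈ I then b i else 1
  have hz : ∀ i, z i ≠ 0 := fun i => by
    by_cases hi : i ∈ I
    · simp only [z, if_pos hi]
      exact fun h => (hb i).1 h hi
    · simp [z, hi]
  have hzb : coordProj I z = b := by
    ext i
    by_cases hi : i ∈ I
    · rw [coordProj_apply_of_mem hi]; exact if_pos hi
    · rw [coordProj_mem I z i hi, (hb i).2 hi]
  have hgz : ∀ v, fderiv ℝ g z v = fderiv ℝ g b (coordProj I v) := fun v => by
    rw [hgd, hface, fderiv_sum_mixedMonomial]
    refine Finset.sum_congr rfl fun m hm => ?_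
    rw [fderiv_mixedMonomial_of_supportedOn (Finset.mem_filter.1 hm).2, hzb]
  refine h_nondeg Δ hΔ z hz fun hli => hc₁ ?_
  have hdiff : DifferentiableAt ℝ g z := differentiable_fn _ z
  obtain ⟨h1, h2⟩ := LinearIndependent.pair_iff.1 hli c₁.1 c₁.2.1 (by
    ext v
    have h3 := hrel ⟨coordProj I v, coordProj_mem I v⟩
    simp only [hσ, zero_mul, add_zero] at h3
    change c₁.1 * dRe g z v + c₁.2.1 * dIm g z v = 0
    rwa [dRe_apply hdiff, dIm_apply hdiff, hgz])
  exact Prod.ext h1 (Prod.ext h2 hσ)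

end Independence

/-! ### From independence to smoothness and transversality. -/

section Consequences

variable {f : MixedPoly n} {I : Finset (Fin n)} {a : coordSubspace I}

theorem dRe_restrictFn (f : MixedPoly n) (a v : coordSubspace I) :
    dRe (f.restrictFn I) a v = (fderiv ℝ f.fn a v).re := by
  rw [dRe_apply (hasFDerivAt_restrictFn f I a).differentiableAt,
    (hasFDerivAt_restrictFn f I a).fderiv]
  rfl

theorem dIm_restrictFn (f : MixedPoly n) (a v : coordSubspace I) :
    dIm (f.restrictFn I) a v = (fderiv ℝ f.fn a v).im := by
  rw [dIm_apply (hasFDerivAt_restrictFn f I a).differentiableAt,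
    (hasFDerivAt_restrictFn f I a).fderiv]
  rfl

theorem RadiallyIndependent.not_isCriticalPt (h : RadiallyIndependent f.fn I a) :
    ¬ IsCriticalPt (f.restrictFn I) a := by
  refine not_not.2 (LinearIndependent.pair_iff.2 fun s t hst => ?_)
  have h0 := h (s, t, 0) fun v hv => by
    have h1 := congrArg (fun l => l ⟨v, hv⟩) hst
    change s * dRe (f.restrictFn I) a ⟨v, hv⟩ + t * dIm (f.restrictFn I) a ⟨v, hv⟩ = 0 at h1
    rw [dRe_restrictFn, dIm_restrictFn] at h1
    simpa using h1
  exact ⟨congrArg Prod.fst h0, congrArg (fun q => q.2.1) h0⟩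

/-- The sphere's tangent space is the kernel of one real functional, so a single vector tangent to
the stratum on which that functional is nonzero suffices. -/
theorem RadiallyIndependent.tangentStratum_sup_tangentSphere
    (h : RadiallyIndependent f.fn I a) :
    tangentStratum f I a ⊔ tangentSphere (a : Cn n) = ⊤ := by
  let φ : coordSubspace I →ₗ[ℝ] ℝ :=
    { toFun := fun v => (inner ℂ (a : Cn n) (v : Cn n)).re
      map_add' := fun u v => by simp
      map_smul' := fun r v => by
        simp only [Submodule.coe_smul_of_tower, inner_smul_right_eq_smul, Complex.smul_re,
          RingHom.id_apply] }
  obtain ⟨v, hv, hφ⟩ : ∃ v ∈ tangentLevel (f.restrictFn I) a, φ v ≠ 0 := by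
    by_contra! hcon
    -- If the radial functional vanished on the common kernel, it would be a combination of `dRe`
    -- and `dIm`, a relation with coefficient `-1` that independence forbids.
    have hker : ⨅ i, LinearMap.ker (![(dRe (f.restrictFn I) a).toLinearMap,
        (dIm (f.restrictFn I) a).toLinearMap] i) ≤ LinearMap.ker φ := by
      intro v hv
      rw [Submodule.mem_iInf] at hv
      exact hcon v ⟨hv 0, hv 1⟩
    have hspan := mem_span_of_iInf_ker_le_ker hker
    rw [Matrix.range_cons, Matrix.range_cons, Matrix.range_empty, Set.union_empty,
      Set.singleton_union, Submodule.mem_span_pair] at hspan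
    obtain ⟨s, t, hst⟩ := hspan
    have h0 := h (s, t, -1) fun v hv => by
      have h1 := congrArg (fun l => l ⟨v, hv⟩) hst
      change s * dRe (f.restrictFn I) a ⟨v, hv⟩ + t * dIm (f.restrictFn I) a ⟨v, hv⟩ =
        (inner ℂ (a : Cn n) v).re at h1
      rw [dRe_restrictFn, dIm_restrictFn] at h1
      simp only
      linarith
    have h2 : (-1 : ℝ) = 0 := congrArg (fun q => q.2.2) h0
    norm_num at h2
  refine eq_top_iff.2 fun u _ => ?_
  have hφv : (inner ℂ (a : Cn n) (v : Cn n)).re ≠ 0 := hφ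
  set r := (inner ℂ (a : Cn n) u).re / (inner ℂ (a : Cn n) (v : Cn n)).re with hr
  refine Submodule.mem_sup.2 ⟨r • (v : Cn n), ?_, u - r • (v : Cn n), ?_, by abel⟩
  · exact Submodule.smul_mem _ r (Submodule.mem_map.2 ⟨v, hv, rfl⟩)
  · change (inner ℂ (a : Cn n) (u - r • (v : Cn n))).re = 0
    rw [inner_sub_right, inner_smul_right_eq_smul, Complex.sub_re, Complex.smul_re, smul_eq_mul,
      hr, div_mul_cancel₀ _ hφv, sub_self]

end Consequences

end MixedNewton

end

open MixedNewton
theorem proposition3p1 (n : ℕ) (f : MixedFamily n)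
    (h_zero : ∀ᶠ t in 𝓝 (0 : ℂ), (0 : Cn n) ∈ hypersurface (f.fiber t))
    (h_ne : ∀ᶠ t in 𝓝 (0 : ℂ), ¬ ∀ᶠ z in 𝓝 (0 : Cn n), (f.fiber t).fn z = 0)
    (h_boundary : ∀ᶠ t in 𝓝 (0 : ℂ), newtonBoundary (f.fiber t) = newtonBoundary (f.fiber 0))
    (h_nondeg : ∀ᶠ t in 𝓝 (0 : ℂ), StronglyNonDegenerate (f.fiber t)) :
    ∃ R : ℝ, 0 < R ∧ ∀ᶠ t in 𝓝 (0 : ℂ), ∀ I ∈ nonVanishing (f.fiber 0),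
      MixedNonSingularOn (f.fiber t) I R ∧
        ∀ r : ℝ, 0 < r → r < R → TransverseToSphere (f.fiber t) I R r := by
  have key : ∀ᶠ p in 𝓝 ((0 : ℂ), (0 : Cn n)), ∀ I : Finset (Fin n),
      I ∈ nonVanishing (f.fiber 0) → p.2 ∈ hypersurface (f.fiber p.1) → p.2 ∈ coordTorus I →
        RadiallyIndependent (f.fiber p.1).fn I p.2 := by
    refine eventually_all.2 fun I => ?_
    by_cases hI : I ∈ nonVanishing (f.fiber 0)
    · filter_upwards [eventually_radiallyIndependent f h_zero.self_of_nhds h_boundary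
        h_nondeg.self_of_nhds hI] with p hp _ using hp
    · exact Eventually.of_forall fun p h => absurd h hI
  -- A product neighbourhood of `(0, 0)` separates the variables, giving one radius `R` valid for
  -- all small `t` and, since there are finitely many, for all `I`.
  rw [nhds_prod_eq, eventually_prod_iff] at key
  obtain ⟨pt, hpt, pz, hpz, hkey⟩ := key
  obtain ⟨R, hR, hball⟩ := Metric.eventually_nhds_iff_ball.1 hpz
  refine ⟨R, hR, hpt.mono fun t ht I hI => ?_⟩
  have hind : ∀ a : coordSubspace I,
      (a : Cn n) ∈ hypersurface (f.fiber t) ∩ coordTorus I ∩ Metric.ball 0 R →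
        RadiallyIndependent (f.fiber t).fn I a := fun a ha =>
    hkey ht (hball a ha.2) I hI ha.1.1 ha.1.2
  exact ⟨fun a ha => (hind a ha).not_isCriticalPt,
    fun r _ _ a ha _ => (hind a ha).tangentStratum_sup_tangentSphere⟩
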